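/- All graphs are finite and simple. Let $G$ be a graph, with vertex set $V(G)$, edge set $E(G)$, minimum degree $\delta(G)$ and independence number $\alpha(G)$. Let $\mathbb{Z}^+$ denote the set of positive integers, and let $g,f:V(G)\to\mathbb{Z}^+$ satisfy $g(x)\le f(x)$ for all $x\in V(G)$. A fractional $(g,f)$-factor of $G$ with indicator function $h:E(G)\to[0,1]$ is the spanning subgraph with edge set $\{e\in E(G): h(e)\neq 0\}$, where $h$ satisfies $g(x)\le\sum_{e\ni x}h(e)\le f(x)$ for every $x\in V(G)$ (the sum runs over the edges of $G$ incident with $x$). $G$ is called a fractional $(g,f)$-covered graph if for every $e\in E(G)$ it has a fractional $(g,f)$-factor with indicator function $h$ such that $h(e)=1$. $G$ is called a fractional $(g,f,n)$-critical covered graph if after removing any $n$ vertices of $G$ the resulting graph is a fractional $(g,f)$-covered graph (with $g$ and $f$ restricted to the remaining vertices). Theorem. Let $a$, $b$ and $n$ be integers with $n\ge 0$, $a\ge 1$ and $b\ge\max\{a,2\}$. Let $G$ be a graph of order $p$ with $$p\ge\frac{(a+b-1)(a+b-2)+an+1}{a},$$ and let $g,f:V(G)\to\mathbb{Z}^+$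 be functions such that $a\le g(x)\le f(x)\le b$ for all $x\in V(G)$. If $$\delta(G)\ge\frac{(b-1)p+an+a+b+1}{a+b-1}$$ and $$\delta(G)>\frac{(b-2)p+2\alpha(G)+an+1}{a+b-2},$$ then $G$ is a fractional $(g,f,n)$-critical covered graph. -/

import Mathlib

namespace SimpleGraph

open Classical in
/-- The fractional degree of `x`: the sum of `h e` over the edges `e` of `G` incident with `x`.
Only the values of `h` on the edges of `G` matter. -/
noncomputable def fracDegree {V : Type*} [Fintype V] (G : SimpleGraph V)
    (h : Sym2 V → ℝ) (x : V) : ℝ :=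
  ∑ e ∈ G.incidenceFinset x, h e

/-- `h` is the indicator function of a fractional `(g, f)`-factor of `G`: it maps the edges
of `G` to `[0, 1]`, and every fractional degree lies between `g x` and `f x`. The factor itself
is the spanning subgraph whose edges are the edges `e` of `G` with `h e ≠ 0`. -/
structure IsFractionalFactor {V : Type*} [Fintype V] (G : SimpleGraph V)
    (g f : V → ℕ) (h : Sym2 V → ℝ) : Prop where
  mem_Icc : ∀ e ∈ G.edgeSet, h e ∈ Set.Icc (0 : ℝ) 1
  lower : ∀ x, (g x : ℝ) ≤ G.fracDegree h x
  upper : ∀ x, G.fracDegree h x ≤ (f x : ℝ)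

/-- `G` is fractional `(g, f)`-covered: for every edge `e` of `G` there is a fractional
`(g, f)`-factor with indicator function `h` such that `h e = 1`. -/
def IsFractionalCovered {V : Type*} [Fintype V] (G : SimpleGraph V) (g f : V → ℕ) : Prop :=
  ∀ e ∈ G.edgeSet, ∃ h : Sym2 V → ℝ, G.IsFractionalFactor g f h ∧ h e = 1

open Classical in
/-- `G` is fractional `(g, f, n)`-critical covered: after removing any `n` vertices, the
remaining induced subgraph is fractional `(g, f)`-covered, with `g` and `f` restricted. -/
def IsFractionalCriticalCovered {V : Type*} [Fintype V] (G : SimpleGraph V)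
    (g f : V → ℕ) (n : ℕ) : Prop :=
  ∀ N : Finset V, N.card = n →
    (G.induce {v : V | v ∉ N}).IsFractionalCovered (fun v => g v) (fun v => f v)

end SimpleGraph

namespace SimpleGraph

open Finset
-- Fix an edge `e₀` and, among weightings in `[0, 1]` with weight 1 on `e₀`, minimise the sum of
-- squared distances from the degrees to the intervals `[g x, f x]` (`exists_weight_fracDefect`). If
-- some distance is nonzero, let `T` and `S` be the vertices of largest deficit and largest excess,
-- one of them possibly empty. Optimality saturates the edges from `T` to vertices outside `S` and
-- empties those from `S` to vertices outside `T`, except `e₀`. Double counting the weight between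
-- `S` and `T` then violates a Tutte-type inequality, which therefore suffices
-- (`isFractionalCovered_of_forall_le`).
--
-- `min_two_add_sum_le` derives this inequality from the numerical hypotheses. With `d` the least
-- degree of a vertex of `T` outside `S`, the case `d = 0` uses the independence number and `d ≥ 1`
-- uses the minimum degree, with the bound on the order needed only for `d ≥ 2`. Deleting `n`
-- vertices lowers degrees by at most `n` and does not raise the independence number.
open scoped Classical in
lemma fracDegree_eq_sum_ite {V : Type*} [Fintype V] (G : SimpleGraph V) (h : Sym2 V → ℝ) (x : V) :
    G.fracDegree h x = ∑ y, if G.Adj x y then h s(x, y) else 0 := by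
  rw [← Finset.sum_filter]
  unfold fracDegree
  symm
  refine Finset.sum_bij (fun y _ => s(x, y)) ?_ ?_ ?_ ?_
  · intro y hy
    simpa [mem_incidenceFinset, mk'_mem_incidenceSet_iff] using hy
  · intro y _ z _ hyz
    exact Sym2.congr_right.1 hyz
  · intro e he
    induction e with | _ u v
    rw [mem_incidenceFinset, mk'_mem_incidenceSet_iff] at he
    obtain ⟨huv, rfl | rfl⟩ := he
    · exact ⟨v, by simpa using huv, rfl⟩
    · exact ⟨u, by simpa using huv.symm, Sym2.eq_swap⟩
  · intros; rfl

/-! ### Projection onto an interval and defects -/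

/-- The nearest point of `[l, u]` to `t` (for `l ≤ u`). -/
noncomputable def clamp (l u t : ℝ) : ℝ := max l (min t u)

lemma clamp_mem {l u : ℝ} (hlu : l ≤ u) (t : ℝ) : clamp l u t ∈ Set.Icc l u := by
  unfold clamp
  exact ⟨le_max_left _ _, max_le hlu (min_le_right _ _)⟩

/-- After a perturbation the old nearest point can stay as the target, so the objective is bounded
without differentiating `clamp`. -/
lemma sq_clamp_sub_le {l u r : ℝ} (hr : r ∈ Set.Icc l u) (t : ℝ) :
    (clamp l u t - t) ^ 2 ≤ (r - t) ^ 2 := by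
  obtain ⟨h1, h2⟩ := hr
  unfold clamp
  rw [sq_le_sq]
  rcases le_total t u with h | h
  · rw [min_eq_left h]
    rcases le_total l t with h' | h'
    · simp [h']
    · rw [max_eq_left h', abs_of_nonneg (by linarith), abs_of_nonneg (by linarith)]
      linarith
  · rw [min_eq_right h, max_eq_right (by linarith), abs_of_nonpos (by linarith),
      abs_of_nonpos (by linarith)]
    linarith

lemma clamp_eq_left {l u t : ℝ} (hlu : l ≤ u) (h : 0 < clamp l u t - t) : clamp l u t = l := by
  unfold clamp at *
  rcases le_total t u with h1 | h1
  · rw [min_eq_left h1] at *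
    rcases le_total l t with h2 | h2
    · rw [max_eq_right h2] at h; linarith
    · exact max_eq_left h2
  · rw [min_eq_right h1, max_eq_right hlu] at h; linarith

lemma clamp_eq_right {l u t : ℝ} (hlu : l ≤ u) (h : clamp l u t - t < 0) : clamp l u t = u := by
  unfold clamp at *
  rcases le_total t u with h1 | h1
  · rw [min_eq_left h1] at h
    linarith [le_max_right l t]
  · rw [min_eq_right h1, max_eq_right hlu]

/-- The signed distance from the fractional degree of `x` to the interval `[g x, f x]`. -/
noncomputable def fracDefect {V : Type*} [Fintype V] (G : SimpleGraph V) (g f : V → ℕ)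
    (h : Sym2 V → ℝ) (x : V) : ℝ :=
  clamp (g x) (f x) (G.fracDegree h x) - G.fracDegree h x

lemma continuous_fracDefect {V : Type*} [Fintype V] (G : SimpleGraph V) (g f : V → ℕ) (x : V) :
    Continuous fun h => G.fracDefect g f h x := by
  unfold fracDefect clamp fracDegree
  fun_prop

open scoped Classical in
lemma fracDegree_update {V : Type*} [Fintype V] (G : SimpleGraph V) (h : Sym2 V → ℝ)
    {x y : V} (hxy : G.Adj x y) (c : ℝ) (z : V) :
    G.fracDegree (Function.update h s(x, y) (h s(x, y) + c)) z =
      G.fracDegree h z + if z = x ∨ z = y then c else 0 := by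
  unfold fracDegree
  have key : ∀ e ∈ G.incidenceFinset z, Function.update h s(x, y) (h s(x, y) + c) e =
      h e + if e = s(x, y) then c else 0 := by
    intro e _
    by_cases he : e = s(x, y)
    · subst he; simp
    · simp [he]
  rw [Finset.sum_congr rfl key, Finset.sum_add_distrib, Finset.sum_ite_eq']
  congr 1
  simp [mem_incidenceFinset, mk'_mem_incidenceSet_iff, hxy]

/-! ### Optimal weightings and the Tutte-type condition -/

/-- Among the weightings of the edges in `[0, 1]` with weight `1` on `e₀` there is one that
satisfies the first-order optimality conditions for the sum of the squared defects. -/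
lemma exists_weight_fracDefect {V : Type*} [Fintype V] (G : SimpleGraph V) (g f : V → ℕ)
    (hgf : ∀ x, g x ≤ f x) (e₀ : Sym2 V) :
    ∃ h : Sym2 V → ℝ, (∀ e, h e ∈ Set.Icc (0 : ℝ) 1) ∧ h e₀ = 1 ∧
      ∀ x y, G.Adj x y → s(x, y) ≠ e₀ →
        (0 < G.fracDefect g f h x + G.fracDefect g f h y → h s(x, y) = 1) ∧
        (G.fracDefect g f h x + G.fracDefect g f h y < 0 → h s(x, y) = 0) := by
  classical
  let B : Set (Sym2 V → ℝ) :=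
    Set.pi Set.univ fun e => if e = e₀ then {(1 : ℝ)} else Set.Icc (0 : ℝ) 1
  have hB : IsCompact B := by
    refine isCompact_univ_pi fun e => ?_
    split_ifs
    exacts [isCompact_singleton, isCompact_Icc]
  have hmem : ∀ h, h ∈ B ↔ (∀ e, h e ∈ Set.Icc (0 : ℝ) 1) ∧ h e₀ = 1 := by
    intro h
    simp only [B, Set.mem_univ_pi]
    constructor
    · intro H
      have h0 : h e₀ = 1 := by simpa using H e₀
      refine ⟨fun e => ?_, h0⟩
      by_cases he : e = e₀
      · subst he; simp [h0]
      · simpa [he] using H e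
    · rintro ⟨H, h0⟩ e
      by_cases he : e = e₀
      · subst he; simp [h0]
      · simpa [he] using H e
  have hne : B.Nonempty := ⟨fun _ => 1, (hmem _).2 ⟨fun _ => by simp, rfl⟩⟩
  have hcont : Continuous fun h : Sym2 V → ℝ => ∑ x, (G.fracDefect g f h x) ^ 2 :=
    continuous_finsetSum _ fun x _ => (G.continuous_fracDefect g f x).pow 2
  obtain ⟨h, hhB, hmin⟩ := hB.exists_isMinOn hne
    hcont.continuousOn
  obtain ⟨hI, h1⟩ := (hmem h).1 hhB
  refine ⟨h, hI, h1, fun x y hxy hne => ?_⟩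
  -- Changing one weight by `c` moves only the degrees of `x` and `y`. With the old targets, the
  -- objective grows by at most `2 * c ^ 2` minus `2 * c` times the sum of the two defects.
  have key : ∀ c : ℝ, h s(x, y) + c ∈ Set.Icc (0 : ℝ) 1 →
      c * (G.fracDefect g f h x + G.fracDefect g f h y) ≤ c ^ 2 := by
    intro c hc
    have hB' : Function.update h s(x, y) (h s(x, y) + c) ∈ B := by
      refine (hmem _).2 ⟨fun e => ?_, ?_⟩
      · by_cases he : e = s(x, y)
        · subst he; simpa using hc
        · simpa [he] using hI e
      · simpa [hne.symm] using h1
    have hle := hmin hB'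
    replace hle : ∑ z, (G.fracDefect g f h z) ^ 2 ≤
        ∑ z, (G.fracDefect g f (Function.update h s(x, y) (h s(x, y) + c)) z) ^ 2 := hle
    have hle2 : ∑ z, (G.fracDefect g f (Function.update h s(x, y) (h s(x, y) + c)) z) ^ 2 ≤
        ∑ z, ((G.fracDefect g f h z) ^ 2 +
          ((if z = x then c ^ 2 - 2 * c * G.fracDefect g f h z else 0) +
           (if z = y then c ^ 2 - 2 * c * G.fracDefect g f h z else 0))) := by
      refine Finset.sum_le_sum fun z _ => ?_
      have := sq_clamp_sub_le (clamp_mem (Nat.cast_le.2 (hgf z)) (G.fracDegree h z))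
        (G.fracDegree (Function.update h s(x, y) (h s(x, y) + c)) z)
      refine this.trans (le_of_eq ?_)
      rw [G.fracDegree_update h hxy]
      have hxy' : x ≠ y := hxy.ne
      unfold fracDefect
      by_cases hzx : z = x
      · subst hzx
        simp only [true_or, if_true, if_neg hxy']
        ring
      · by_cases hzy : z = y
        · simp only [hzy, or_true, if_true, if_neg hxy'.symm]
          ring
        · simp [hzx, hzy]
    rw [Finset.sum_add_distrib, Finset.sum_add_distrib, Finset.sum_ite_eq', Finset.sum_ite_eq']
      at hle2
    simp only [Finset.mem_univ, if_true] at hle2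
    linarith [hle.trans hle2]
  obtain ⟨hl, hu⟩ := hI s(x, y)
  set L := G.fracDefect g f h x + G.fracDefect g f h y
  constructor
  · intro hpos
    by_contra hlt
    have hlt : 0 < 1 - h s(x, y) := by
      have := lt_of_le_of_ne hu hlt
      linarith
    -- This step is feasible and smaller than `L`, so `c * L ≤ c ^ 2` fails.
    have hc : 0 < min (1 - h s(x, y)) (L / 2) := lt_min hlt (by linarith)
    have := key _ ⟨by linarith, by linarith [min_le_left (1 - h s(x, y)) (L / 2)]⟩
    rw [pow_two] at this
    linarith [le_of_mul_le_mul_left this hc, min_le_right (1 - h s(x, y)) (L / 2)]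
  · intro hneg
    by_contra hlt
    have hlt : 0 < h s(x, y) := lt_of_le_of_ne hl (Ne.symm hlt)
    have hc : 0 < min (h s(x, y)) (-L / 2) := lt_min hlt (by linarith)
    have := key (-min (h s(x, y)) (-L / 2))
      ⟨by linarith [min_le_left (h s(x, y)) (-L / 2)], by linarith⟩
    rw [neg_sq, pow_two, neg_mul, ← mul_neg] at this
    linarith [le_of_mul_le_mul_left this hc, min_le_right (h s(x, y)) (-L / 2)]

open scoped Classical in
/-- A sufficient condition of Tutte type for being fractional `(g, f)`-covered. -/
theorem isFractionalCovered_of_forall_le {V : Type*} [Fintype V] (G : SimpleGraph V)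
    (g f : V → ℕ) (hgf : ∀ x, g x ≤ f x)
    (H : ∀ S T : Finset V, Disjoint S T →
      min 2 #S + ∑ x ∈ T, g x ≤ ∑ x ∈ S, f x + ∑ x ∈ T, #{y | G.Adj x y ∧ y ∉ S}) :
    G.IsFractionalCovered g f := by
  intro e₀ _
  obtain ⟨h, hI, h1, hopt⟩ := G.exists_weight_fracDefect g f hgf e₀
  refine ⟨h, ?_, h1⟩
  suffices hz : ∀ x, G.fracDefect g f h x = 0 by
    have hd : ∀ x, G.fracDegree h x ∈ Set.Icc (g x : ℝ) (f x) := by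
      intro x
      have := clamp_mem (Nat.cast_le (α := ℝ).2 (hgf x)) (G.fracDegree h x)
      rwa [sub_eq_zero.1 (hz x)] at this
    exact ⟨fun e _ => hI e, fun x => (hd x).1, fun x => (hd x).2⟩
  by_contra! hne
  obtain ⟨x₀, hx₀⟩ := hne
  set d := G.fracDefect g f h with hd
  obtain ⟨x₁, -, hmax⟩ := Finset.exists_max_image univ (fun x => |d x|) ⟨x₀, mem_univ _⟩
  set m := |d x₁| with hm
  have hm0 : 0 < m := (abs_pos.2 hx₀).trans_le (hmax x₀ (mem_univ _))
  have hle : ∀ x, -m ≤ d x ∧ d x ≤ m := fun x => abs_le.1 (hmax x (mem_univ _))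
  -- Extremality fixes signs: a vertex of `T` has positive defect sum with any vertex outside `S`,
  -- and a vertex of `S` negative sum with any vertex outside `T`.
  set S : Finset V := {x | d x = -m} with hS
  set T : Finset V := {x | d x = m} with hT
  have hST : Disjoint S T := by
    rw [Finset.disjoint_left]
    intro x hx hx'
    simp only [hS, hT, mem_filter, mem_univ, true_and] at hx hx'
    linarith
  have hpos : (1 : ℝ) ≤ #S + #T := by
    have : x₁ ∈ S ∪ T := by
      rcases abs_choice (d x₁) with h' | h'
      · simp only [hS, hT, mem_union, mem_filter, mem_univ, true_and]; right; rw [hm, h']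
      · simp only [hS, hT, mem_union, mem_filter, mem_univ, true_and]; left; rw [hm, h', neg_neg]
    have := (Finset.card_pos.2 ⟨x₁, this⟩).trans_le (Finset.card_union_le S T)
    exact_mod_cast this
  set w : V → V → ℝ := fun x y => if G.Adj x y then h s(x, y) else 0 with hw
  have hsymm : ∀ x y, w x y = w y x := by
    intro x y
    simp only [hw, G.adj_comm x y, Sym2.eq_swap]
  have hdeg : ∀ x, G.fracDegree h x = ∑ y, w x y := G.fracDegree_eq_sum_ite h
  have hTdeg : ∀ x ∈ T, (g x : ℝ) - m =
      ∑ y ∈ S, w x y + (#{y | G.Adj x y ∧ y ∉ S} : ℝ) := by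
    intro x hx
    have hx : d x = m := by simpa [hT] using hx
    have hg : (g x : ℝ) - m = G.fracDegree h x := by
      have := clamp_eq_left (Nat.cast_le (α := ℝ).2 (hgf x)) (t := G.fracDegree h x)
        (by change 0 < d x; rw [hx]; exact hm0)
      have hx' : clamp (g x) (f x) (G.fracDegree h x) - G.fracDegree h x = m := hx
      linarith
    rw [hg, hdeg, ← Finset.sum_add_sum_compl S]
    congr 1
    rw [Finset.card_filter, Nat.cast_sum, ← Finset.sum_add_sum_compl S,
      Finset.sum_eq_zero (s := S) (fun y hy => by simp [hy]), zero_add]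
    refine Finset.sum_congr rfl fun y hy => ?_
    have hy : y ∉ S := by simpa using hy
    by_cases hxy : G.Adj x y
    · have : d y ≠ -m := by simpa [hS] using hy
      have hlt : 0 < d x + d y := by
        have := lt_of_le_of_ne (hle y).1 this.symm
        linarith
      have : h s(x, y) = 1 := by
        by_cases he : s(x, y) = e₀
        · rw [he, h1]
        · exact (hopt x y hxy he).1 hlt
      simp [hw, hxy, hy, this]
    · simp [hw, hxy]
  have hSdeg : ∀ x ∈ S, (f x : ℝ) + m ≤ ∑ y ∈ T, w x y + if x ∈ e₀ then 1 else 0 := by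
    intro x hx
    have hx : d x = -m := by simpa [hS] using hx
    have hf : (f x : ℝ) + m = G.fracDegree h x := by
      have := clamp_eq_right (Nat.cast_le (α := ℝ).2 (hgf x)) (t := G.fracDegree h x)
        (by change d x < 0; rw [hx]; linarith)
      have hx' : clamp (g x) (f x) (G.fracDegree h x) - G.fracDegree h x = -m := hx
      linarith
    rw [hf, hdeg, ← Finset.sum_add_sum_compl T]
    gcongr
    have hb : ∀ y ∈ Tᶜ, w x y ≤ if s(x, y) = e₀ then 1 else 0 := by
      intro y hy
      have hy : d y ≠ m := by simpa [hT] using hy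
      have hlt : d x + d y < 0 := by
        have := lt_of_le_of_ne (hle y).2 hy
        linarith
      by_cases he : s(x, y) = e₀
      · simp only [hw, he, if_true, h1]
        split_ifs <;> norm_num
      · by_cases hxy : G.Adj x y
        · simp [hw, he, hxy, (hopt x y hxy he).2 hlt]
        · simp [hw, he, hxy]
    refine (Finset.sum_le_sum hb).trans ?_
    split_ifs with hxe
    · obtain ⟨z, rfl⟩ := hxe
      simp only [Sym2.congr_right]
      rw [Finset.sum_ite_eq']
      split_ifs <;> norm_num
    · refine (Finset.sum_eq_zero fun y _ => if_neg ?_).le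
      rintro rfl
      exact hxe (Sym2.mem_mk_left x y)
  -- The forced edge `e₀` has two ends, hence the term `min 2 #S`.
  have hE : ∑ x ∈ S, (if x ∈ e₀ then (1 : ℝ) else 0) ≤ (min 2 #S : ℕ) := by
    rw [← Finset.sum_filter, Finset.sum_const, nsmul_one]
    refine Nat.cast_le.2 (le_min ?_ (Finset.card_filter_le _ _))
    induction e₀ with | _ u v
    refine (Finset.card_le_card (t := {u, v}) ?_).trans Finset.card_le_two
    intro x hx
    simpa using (Finset.mem_filter.1 hx).2
  have hTsum := Finset.sum_congr rfl hTdeg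
  have hSsum := Finset.sum_le_sum hSdeg
  rw [Finset.sum_sub_distrib, Finset.sum_add_distrib, Finset.sum_const, nsmul_eq_mul] at hTsum
  rw [Finset.sum_add_distrib, Finset.sum_add_distrib, Finset.sum_const, nsmul_eq_mul,
    Finset.sum_comm] at hSsum
  have hcomm : ∑ y ∈ T, ∑ x ∈ S, w x y = ∑ x ∈ T, ∑ y ∈ S, w x y :=
    Finset.sum_congr rfl fun x _ => Finset.sum_congr rfl fun y _ => hsymm y x
  have hH : ((min 2 #S : ℕ) : ℝ) + ∑ x ∈ T, (g x : ℝ) ≤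
      ∑ x ∈ S, (f x : ℝ) + ∑ x ∈ T, (#{y | G.Adj x y ∧ y ∉ S} : ℝ) := by
    exact_mod_cast H S T hST
  -- Eliminating the weight between `S` and `T` leaves `m * (#S + #T) ≤ 0`.
  nlinarith

/-! ### From degrees and independence number to the Tutte-type condition -/

open scoped Classical in
/-- Away from `S`, a set `T` in which many vertices have degree at most one contains a large
independent set. -/
lemma two_mul_card_le_sum_add_two_mul_indepNum {V : Type*} [Fintype V] (G : SimpleGraph V)
    {S T : Finset V} (hST : Disjoint S T) :
    2 * #T ≤ ∑ x ∈ T, #{y | G.Adj x y ∧ y ∉ S} + 2 * G.indepNum := by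
  -- A largest independent subset of `T` dominates the rest of `T`.
  obtain ⟨I, hI, hmax⟩ := Finset.exists_max_image
    (T.powerset.filter fun I : Finset V => G.IsIndepSet (I : Set V)) Finset.card
    ⟨∅, by simp⟩
  simp only [mem_filter, mem_powerset] at hI hmax
  obtain ⟨hIT, hIind⟩ := hI
  have hcard : #I ≤ G.indepNum := hIind.card_le_indepNum
  have hdom : ∀ x ∈ T \ I, ∃ y ∈ I, G.Adj y x := by
    intro x hx
    obtain ⟨hxT, hxI⟩ := mem_sdiff.1 hx
    by_contra! hno
    have hins := hmax (insert x I) ⟨insert_subset hxT hIT, by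
      rw [Finset.coe_insert]
      refine hIind.insert fun y hy _ => ?_
      exact ⟨fun h => hno y hy h.symm, hno y hy⟩⟩
    rw [card_insert_of_notMem hxI] at hins
    omega
  have hsub : #(T \ I) ≤ ∑ y ∈ I, #{x | G.Adj y x ∧ x ∉ S} := by
    refine (card_le_card (t := I.biUnion fun y => ({x | G.Adj y x ∧ x ∉ S} : Finset V)) ?_).trans
      card_biUnion_le
    intro x hx
    obtain ⟨y, hy, hyx⟩ := hdom x hx
    simp only [mem_biUnion, mem_filter, mem_univ, true_and]
    exact ⟨y, hy, hyx, fun hxS => Finset.disjoint_left.1 hST hxS (mem_sdiff.1 hx).1⟩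
  have hone : #(T \ I) ≤ ∑ x ∈ T \ I, #{y | G.Adj x y ∧ y ∉ S} := by
    rw [Finset.card_eq_sum_ones]
    refine Finset.sum_le_sum fun x hx => ?_
    obtain ⟨y, hy, hyx⟩ := hdom x hx
    refine Finset.card_pos.2 ⟨y, ?_⟩
    simp only [mem_filter, mem_univ, true_and]
    exact ⟨hyx.symm, fun hyS => Finset.disjoint_left.1 hST hyS (hIT hy)⟩
  have h1 := Finset.sum_sdiff hIT (f := fun x => #{y | G.Adj x y ∧ y ∉ S})
  have h2 := Finset.card_sdiff_add_card_eq_card hIT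
  -- The degree sum covers `#(T \ I)` twice: once from `I`, once from `T \ I`.
  omega

open scoped Classical in
/-- The degree and independence number conditions on a graph in which all degrees are at
least `k - n` give the Tutte-type inequality. -/
lemma min_two_add_sum_le {V : Type*} [Fintype V] (G : SimpleGraph V) {a b n k p : ℕ}
    (hcardp : Nat.card V + n = p) (ha : 1 ≤ a) (hb : 2 ≤ b) (g f : V → ℕ) (haf : ∀ x, a ≤ f x) (hgb : ∀ x, g x ≤ b)
    (hk : ∀ x, k ≤ #{y | G.Adj x y} + n)
    (hp : ((a : ℝ) + b - 1) * (a + b - 2) + a * n + 1 ≤ a * p)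
    (hδ : ((b : ℝ) - 1) * p + a * n + a + b + 1 ≤ k * (a + b - 1))
    (hα : ((b : ℝ) - 2) * p + 2 * G.indepNum + a * n + 1 < k * (a + b - 2))
    {S T : Finset V} (hST : Disjoint S T) :
    min 2 #S + ∑ x ∈ T, g x ≤ ∑ x ∈ S, f x + ∑ x ∈ T, #{y | G.Adj x y ∧ y ∉ S} := by
  subst hcardp
  rw [Nat.card_eq_fintype_card] at *
  push_cast at hp hδ hα
  by_contra! hlt
  have hgT : ∑ x ∈ T, g x ≤ #T * b := by simpa using Finset.sum_le_card_nsmul T g b fun x _ => hgb x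
  have hfS : #S * a ≤ ∑ x ∈ S, f x := by
    simpa using Finset.card_nsmul_le_sum S f a fun x _ => haf x
  have hmin1 : min 2 #S ≤ 2 := min_le_left _ _
  have hmin2 : min 2 #S ≤ #S * a := (min_le_right _ _).trans (Nat.le_mul_of_pos_right _ ha)
  have hTne : T.Nonempty := by
    rw [Finset.nonempty_iff_ne_empty]
    rintro rfl
    simp only [Finset.sum_empty, add_zero] at hlt
    omega
  obtain ⟨x, hxT, hxmin⟩ := Finset.exists_min_image T (fun x => #{y | G.Adj x y ∧ y ∉ S}) hTne
  set d := #{y | G.Adj x y ∧ y ∉ S} with hd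
  have hdT : #T * d ≤ ∑ x ∈ T, #{y | G.Adj x y ∧ y ∉ S} := by
    simpa using Finset.card_nsmul_le_sum T _ d hxmin
  have hcard : #S + #T ≤ Fintype.card V := by
    rw [← card_union_of_disjoint hST]
    exact card_le_univ _
  have hkd : k ≤ d + #S + n := by
    have h1 : #{y | G.Adj x y} ≤ d + #S := by
      refine (card_le_card ?_).trans (card_union_le _ _)
      intro y hy
      simp only [mem_union, mem_filter, mem_univ, true_and] at hy ⊢
      tauto
    have := hk x
    omega
  have hdb : d < b := by
    by_contra! hbd
    have := Nat.mul_le_mul_left (#T) hbd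
    omega
  -- The `+ 1` is `min 2 #S ≤ 2` less one for the strict inequality.
  have hmain : #S * a + ∑ x ∈ T, #{y | G.Adj x y ∧ y ∉ S} ≤ #T * b + 1 := by omega
  have hα' := G.two_mul_card_le_sum_add_two_mul_indepNum hST
  generalize ∑ x ∈ T, #{y | G.Adj x y ∧ y ∉ S} = D at *
  generalize G.indepNum = α at *
  generalize Fintype.card V = q at *
  generalize #S = s at *
  generalize #T = t at *
  clear_value d
  have ha : (1 : ℝ) ≤ a := by exact_mod_cast ha
  have hb : (2 : ℝ) ≤ b := by exact_mod_cast hb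
  have hcard : (s : ℝ) + t ≤ q := by exact_mod_cast hcard
  have hkd' : (k : ℝ) ≤ d + s + n := by exact_mod_cast hkd
  have hdb' : (d : ℝ) + 1 ≤ b := by exact_mod_cast hdb
  have hdT : (t : ℝ) * d ≤ D := by exact_mod_cast hdT
  have hmain : (s : ℝ) * a + D ≤ t * b + 1 := by exact_mod_cast hmain
  have hα' : 2 * (t : ℝ) ≤ D + 2 * α := by exact_mod_cast hα'
  -- For `d = 0`, eliminating `D` gives `s * (a + b - 2) ≤ (b - 2) * q + 2 * α + 1`, against `hα`
  -- since `k ≤ s + n`.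
  rcases Nat.eq_zero_or_pos d with rfl | hd0
  · have h1 : (k : ℝ) * (a + b - 2) ≤ (s + n) * (a + b - 2) := by
      refine mul_le_mul_of_nonneg_right ?_ (by linarith)
      simpa using hkd'
    have h2 : ((b : ℝ) - 2) * (s + t) ≤ (b - 2) * q :=
      mul_le_mul_of_nonneg_left hcard (by linarith)
    nlinarith
  · have h2 : ((b : ℝ) - d) * (s + t) ≤ (b - d) * q :=
      mul_le_mul_of_nonneg_left hcard (by linarith)
    have h3 : (s : ℝ) * (a + b - d) ≤ (b - d) * q + 1 := by nlinarith
    have h1 : ((k : ℝ) - d - n) * (a + b - d) ≤ s * (a + b - d) :=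
      mul_le_mul_of_nonneg_right (by linarith) (by linarith)
    have h4 : ((k : ℝ) - d - n) * (a + b - d) ≤ (b - d) * q + 1 := h1.trans h3
    rcases Nat.lt_or_ge d 2 with hd2 | hd2
    -- Here `h4` contradicts `hδ` by exactly one: `a + b` against `a + b + 1`.
    · obtain rfl : d = 1 := by omega
      push_cast at h4
      nlinarith
    · have hd2 : (2 : ℝ) ≤ d := by exact_mod_cast hd2
      have hA : (0 : ℝ) < a + b - 1 := by linarith
      have hC : (0 : ℝ) < a + b - d := by linarith
      have h5 := mul_le_mul_of_nonneg_right h4 hA.le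
      have h6 := mul_le_mul_of_nonneg_right hδ hC.le
      have h7 : ((a : ℝ) + b - 1) * (a + b - d) ≤ a * q - 1 := by nlinarith
      have h8 := mul_le_mul_of_nonneg_right h7 (by linarith : (0 : ℝ) ≤ d - 1)
      -- Write `A = a + b - 1`, `C = a + b - d`. Since `(b - 1) * C - (b - d) * A = a * (d - 1)` and
      -- `A - (d - 1) = C`, everything reduces to `2 * C ≤ C`.
      linarith

end SimpleGraph

/-! ### Deleting `n` vertices -/

theorem corollary1 {V : Type*} [Fintype V] (G : SimpleGraph V) [DecidableRel G.Adj]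
    (a b n : ℕ) (ha : 1 ≤ a) (hb : max a 2 ≤ b)
    (hp : (Fintype.card V : ℝ) ≥
      (((a : ℝ) + b - 1) * ((a : ℝ) + b - 2) + (a : ℝ) * n + 1) / (a : ℝ))
    (g f : V → ℕ) (hgf : ∀ x, a ≤ g x ∧ g x ≤ f x ∧ f x ≤ b)
    (hδ : (G.minDegree : ℝ) ≥
      (((b : ℝ) - 1) * (Fintype.card V : ℝ) + (a : ℝ) * n + a + b + 1) / ((a : ℝ) + b - 1))
    (hα : (G.minDegree : ℝ) >
      (((b : ℝ) - 2) * (Fintype.card V : ℝ) + 2 * (G.indepNum : ℝ) + (a : ℝ) * n + 1) /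
        ((a : ℝ) + b - 2)) :
    G.IsFractionalCriticalCovered g f n := by
  classical
  intro N hN
  have hb2 : 2 ≤ b := (le_max_right _ _).trans hb
  have haR : (1 : ℝ) ≤ a := by exact_mod_cast ha
  have hbR : (2 : ℝ) ≤ b := by exact_mod_cast hb2
  have hcard : Nat.card {v : V | v ∉ N} + n = Fintype.card V := by
    have h1 : Nat.card {v : V | v ∉ N} = Fintype.card V - N.card := by
      rw [Nat.card_eq_fintype_card, ← Finset.card_compl, Fintype.card_subtype]
      congr 1
      ext
      simp
    have h2 := N.card_le_univ
    omega
  rw [ge_iff_le, div_le_iff₀ (by linarith)] at hp hδ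
  rw [gt_iff_lt, div_lt_iff₀ (by linarith)] at hα
  have hind : (((G.induce {v : V | v ∉ N}).indepNum : ℕ) : ℝ) ≤ G.indepNum := by
    obtain ⟨I, hI⟩ := (G.induce {v : V | v ∉ N}).exists_isNIndepSet_indepNum
    rw [← hI.card_eq, ← Finset.card_map (Function.Embedding.subtype _)]
    refine Nat.cast_le.2 (SimpleGraph.IsIndepSet.card_le_indepNum ?_)
    intro x hx y hy hxy
    simp only [Finset.coe_map, Set.mem_image] at hx hy
    obtain ⟨x, hx, rfl⟩ := hx
    obtain ⟨y, hy, rfl⟩ := hy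
    exact hI.isIndepSet hx hy fun h => hxy (by rw [h])
  refine SimpleGraph.isFractionalCovered_of_forall_le _ _ _ (fun x => (hgf x).2.1) ?_
  intro S T hST
  refine SimpleGraph.min_two_add_sum_le _ (k := G.minDegree) (n := n) hcard ha hb2 _ _
    (fun x => (hgf x).1.trans (hgf x).2.1) (fun x => (hgf x).2.1.trans (hgf x).2.2) ?_
    (by linarith) hδ (by linarith) hST
  intro x
  refine (G.minDegree_le_degree x).trans ?_
  rw [← hN, ← Finset.card_map (Function.Embedding.subtype _), ← G.card_neighborFinset_eq_degree]
  refine (Finset.card_le_card ?_).trans (Finset.card_union_le _ _)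
  intro y hy
  rw [SimpleGraph.mem_neighborFinset] at hy
  by_cases hyN : y ∈ N
  · exact Finset.mem_union_right _ hyN
  · refine Finset.mem_union_left _ (Finset.mem_map.2 ⟨⟨y, hyN⟩, ?_, rfl⟩)
    simpa using hy
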